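/- **Setting.** A bandit instance with $n$ arms assigns to every arm $a$ a probability distribution $\mathcal D(a)$ on $[0,1]$ with mean $\mu(a)$; all pulls are independent, and each pull (query) of arm $a$ yields a reward distributed as $\mathcal D(a)$. An arm $a$ is $\epsilon$-best if $\mu(a)\ge\max_b\mu(b)-\epsilon$. An *elimination algorithm* is a (possibly randomized) algorithm which starts with the set $S$ of all arms and proceeds in rounds: it pulls each arm of $S$ once; then, depending only on its internal randomness and on the rewards observed so far, it irrevocably discards some arms of $S$ (possibly none, never all); it terminates and returns the remaining arm when $|S|=1$, and otherwise starts the next round. **Theorem.** For every $\beta>0$ there exist $\epsilon_0,\delta_0,\eta>0$ such that for all $0<\epsilon<\epsilon_0$ and $0<\delta<\delta_0$ there is $n_0$ such that for every $n>n_0$ and every elimination algorithm $\mathcal A$ on $n$ arms the following hold. 1. If on every instance with $n$ arms and rewards in $[0,1]$ the algorithm $\mathcal A$ returns an $\epsilon$-best arm with probability at least $1-\delta$, then there is an instance on which the expected number of queries of $\mathcal A$ is at least $$\Big(\frac12-\beta\Big)\frac{n}{\epsilon^2}\log\frac1\delta .$$ 2. (Hard instances.) Let $p\in[0,1]$ with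 $\frac12+\epsilon\le p<\frac12+(1+\eta)\epsilon$, and for each arm $i$ let $H_i$ be the instance in which arm $i$ is Bernoulli with mean $p$ and the other $n-1$ arms are Bernoulli with mean $\frac12$. If for every $i$ the algorithm $\mathcal A$ returns arm $i$ on $H_i$ with probability at least $1-\delta$, then there is an $i$ such that the expected number of queries of $\mathcal A$ on $H_i$ is at least $\big(\frac12-\beta\big)\frac{n}{\epsilon^2}\log\frac1\delta$. Here an execution that never terminates counts as returning no arm. In particular, the worst-case number of queries is at least the same bound. -/

import Mathlib

open MeasureTheory ProbabilityTheory
open scoped ENNReal unitInterval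

noncomputable section

namespace BestArm

/-- A bandit instance with `n` arms: one reward distribution on `[0,1]` per arm. -/
abbrev Bandit (n : ℕ) : Type := Fin n → ProbabilityMeasure I

/-- The mean reward of arm `a`. -/
def mean {n : ℕ} (D : Bandit n) (a : Fin n) : ℝ :=
  ∫ x, (x : ℝ) ∂(D a : Measure I)

/-- Arm `a` is an `ε`-best arm: its mean is within `ε` of the largest mean. -/
def IsEpsBest {n : ℕ} (D : Bandit n) (ε : ℝ) (a : Fin n) : Prop :=
  ∀ b : Fin n, mean D b - ε ≤ mean D a

/-- A reward table: `x t a` is the reward that arm `a` yields if it is pulled in round `t`.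
An algorithm only gets to see the entries of the pulls that it makes. -/
abbrev Rewards (n : ℕ) : Type := ℕ → Fin n → I

/-- All rewards are independent, and every pull of arm `a` is distributed as `D a`. -/
def rewardLaw {n : ℕ} (D : Bandit n) : Measure (Rewards n) :=
  Measure.infinitePi fun _ : ℕ => Measure.pi fun a : Fin n => (D a : Measure I)

/-- A (possibly randomized) elimination algorithm on `n` arms, with internal randomness in `R`.
`surv t r x` is the set of arms that are still present at the beginning of round `t`, when the
internal randomness is `r` and the reward table is `x`. In round `t` each arm of `surv t r x` is
pulled once, and then some of these arms (possibly none, never all) are irrevocably discarded. -/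
structure EliminationAlgorithm (n : ℕ) (R : Type*) [MeasurableSpace R] where
  surv : ℕ → R → Rewards n → Finset (Fin n)
  /-- all arms are present at the start -/
  surv_zero : ∀ r x, surv 0 r x = Finset.univ
  /-- discarded arms never return -/
  surv_succ_subset : ∀ t r x, surv (t + 1) r x ⊆ surv t r x
  /-- at least one arm is kept -/
  surv_nonempty : ∀ t r x, 0 < n → (surv t r x).Nonempty
  /-- what is discarded after round `t` is decided by the internal randomness and by the rewards
  of the pulls made in rounds `0, …, t` -/
  surv_succ_congr : ∀ t r x y, (∀ s ≤ t, ∀ a ∈ surv s r x, x s a = y s a) →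
    surv (t + 1) r x = surv (t + 1) r y
  measurable_surv : ∀ t a, MeasurableSet {p : R × Rewards n | a ∈ surv t p.1 p.2}

namespace EliminationAlgorithm

variable {n : ℕ} {R : Type*} [MeasurableSpace R]

/-- The algorithm terminates, and `a` is the single remaining arm. -/
def Returns (A : EliminationAlgorithm n R) (a : Fin n) (r : R) (x : Rewards n) : Prop :=
  ∃ t : ℕ, 1 ≤ t ∧ A.surv t r x = {a}

/-- The total number of pulls (infinite if the algorithm never terminates). Round `0` always takes
place, and a later round takes place as long as more than one arm is present. -/
def queries (A : EliminationAlgorithm n R) (r : R) (x : Rewards n) : ℝ≥0∞ :=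
  ∑' t : ℕ, if t = 0 ∨ 1 < (A.surv t r x).card then ((A.surv t r x).card : ℝ≥0∞) else 0

/-- The expected number of pulls on the instance `D`, if the internal randomness has law `ρ`. -/
def expectedQueries (A : EliminationAlgorithm n R) (ρ : Measure R) (D : Bandit n) : ℝ≥0∞ :=
  ∫⁻ p, A.queries p.1 p.2 ∂(ρ.prod (rewardLaw D))

/-- The probability, on the instance `D`, that the returned arm satisfies `P`. -/
def probReturns (A : EliminationAlgorithm n R) (ρ : Measure R) (D : Bandit n)
    (P : Fin n → Prop) : ℝ≥0∞ :=
  (ρ.prod (rewardLaw D)) {p | ∃ a, P a ∧ A.Returns a p.1 p.2}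

/-- `A` finds an `ε`-best arm with probability at least `1 - δ`, on every instance with `n` arms
and rewards in `[0,1]`. -/
def Learns (A : EliminationAlgorithm n R) (ρ : Measure R) (ε δ : ℝ) : Prop :=
  ∀ D : Bandit n, ENNReal.ofReal (1 - δ) ≤ A.probReturns ρ D (IsEpsBest D ε)

end EliminationAlgorithm

/-- The arm with reward `1` with probability `p` and reward `0` with probability `1 - p`. -/
def bernoulliArm (p : I) : ProbabilityMeasure I :=
  ⟨bernoulliMeasure 1 0 p, inferInstance⟩

/-- The instance in which arm `i` is Bernoulli with mean `p` and all other arms are fair coins. -/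
def hardInstance (n : ℕ) (p : I) (i : Fin n) : Bandit n :=
  fun a => bernoulliArm (if a = i then p else ⟨1 / 2, by norm_num, by norm_num⟩)

end BestArm

end

/-! ### Densities of finite product measures -/

namespace BestArm

/-! The hard instances `H_i` are compared with the null instance, in which every arm is a fair coin,
over a horizon of `t` rounds that does not depend on `n`.

Lower bound on the null instance. Discarding is irrevocable, so discarding arm `i` is already a
failure on `H_i`, and the log-likelihood ratio of `H_i` against the null needs to be followed only
up to that moment. Under the null it drifts by `-entropy p`, about `-2ε²`, per pull of arm `i`; yet
an event that is likely under the null and has probability at most `δ` on `H_i` forces it down to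
about `log δ`. So arm `i` either stays for `t` rounds, which is expensive for large `t`, or costs
about `log(1/δ)/(2ε²)` pulls (`entropy_mul_pulls_ge`). Summing over the arms gives `n
log(1/δ)/(2ε²)` pulls on the null instance.

Transfer to a hard instance. Under the null the `n` likelihood ratios are pairwise uncorrelated, so
their average is within `√(2^t/n)` of `1` in L². For large `n`, `t` rounds cannot tell the null from
`H_i` with `i` uniform (`sum_integral_hardInstance_ge`), so some `H_i` needs nearly as many pulls
(`exists_le_expectedQueries`). The claim about learners follows by taking `p` slightly above `1/2 +
ε`, where only arm `i` is `ε`-best. -/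

theorem lintegral_pi_prod {ι : Type*} [Fintype ι] {X : ι → Type*} [∀ i, MeasurableSpace (X i)]
    (μ : ∀ i, Measure (X i)) [∀ i, IsProbabilityMeasure (μ i)] {f : ∀ i, X i → ℝ≥0∞}
    (hf : ∀ i, Measurable (f i)) :
    ∫⁻ x, ∏ i, f i (x i) ∂Measure.pi μ = ∏ i, ∫⁻ y, f i y ∂μ i := by
  have hind : iIndepFun (fun i (x : ∀ i, X i) => f i (x i)) (Measure.pi μ) :=
    iIndepFun_pi fun i => (hf i).aemeasurable
  rw [lintegral_prod_eq_prod_lintegral_of_indepFun Finset.univ _ hind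
    fun i => (hf i).comp (measurable_pi_apply i)]
  refine Finset.prod_congr rfl fun i _ => ?_
  exact (measurePreserving_eval μ i).lintegral_comp (hf i)

theorem pi_withDensity {ι : Type*} [Fintype ι] {X : ι → Type*} [∀ i, MeasurableSpace (X i)]
    (μ ν : ∀ i, Measure (X i)) [∀ i, IsProbabilityMeasure (μ i)] [∀ i, IsProbabilityMeasure (ν i)]
    {f : ∀ i, X i → ℝ≥0∞} (hf : ∀ i, Measurable (f i))
    (hν : ∀ i, ν i = (μ i).withDensity (f i)) :
    Measure.pi ν = (Measure.pi μ).withDensity fun x => ∏ i, f i (x i) := by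
  classical
  refine Measure.pi_eq fun s hs => ?_
  rw [withDensity_apply _ (.univ_pi hs), ← lintegral_indicator (.univ_pi hs)]
  have h : (Set.univ.pi s).indicator (fun x : ∀ i, X i => ∏ i, f i (x i)) =
      fun x => ∏ i, (s i).indicator (f i) (x i) := by
    ext x
    by_cases hx : x ∈ Set.univ.pi s
    · rw [Set.indicator_of_mem hx]
      exact Finset.prod_congr rfl fun i _ => (Set.indicator_of_mem (hx i trivial) _).symm
    · rw [Set.indicator_of_notMem hx]
      obtain ⟨i, hi⟩ : ∃ i, x i ∉ s i := by simpa [Set.mem_pi] using hx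
      exact (Finset.prod_eq_zero (Finset.mem_univ i) (Set.indicator_of_notMem hi _)).symm
  rw [h, lintegral_pi_prod μ fun i => (hf i).indicator (hs i)]
  refine Finset.prod_congr rfl fun i _ => ?_
  rw [hν i, withDensity_apply _ (hs i), lintegral_indicator (hs i)]

/-! ### The null instance and likelihood ratios -/

/-- The fair coin. -/
noncomputable def fairArm : ProbabilityMeasure I := bernoulliArm ⟨1 / 2, by norm_num, by norm_num⟩

/-- The instance in which all arms are fair coins. -/
noncomputable def nullInstance (n : ℕ) : Bandit n := fun _ => fairArm

/-- The likelihood ratio of a Bernoulli reward of mean `p` and a fair coin. -/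
def ratio (p x : I) : ℝ := 2 * (1 - p) * (1 - x) + 2 * p * x

theorem ratio_nonneg (p x : I) : 0 ≤ ratio p x := by
  have := p.2.1; have := p.2.2; have := x.2.1; have := x.2.2
  unfold ratio
  have h1 : (0 : ℝ) ≤ 1 - p := by linarith
  have h2 : (0 : ℝ) ≤ 1 - x := by linarith
  positivity

theorem ratio_le_two (p x : I) : ratio p x ≤ 2 := by
  have := p.2.1; have := p.2.2; have := x.2.1; have := x.2.2
  unfold ratio
  have h1 : (0 : ℝ) ≤ 1 - p := by linarith
  have h2 : (0 : ℝ) ≤ 1 - x := by linarith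
  have h3 : 0 ≤ (p : ℝ) * (1 - x) := by positivity
  have h4 : 0 ≤ (x : ℝ) * (1 - p) := by positivity
  nlinarith

/-- Only the rewards `0` and `1` occur, but the affine interpolation between them keeps the density
positive and bounded on all of `[0,1]`, so that later estimates hold pointwise and not just almost
surely. -/
theorem ratio_pos {p : I} (hp0 : 0 < (p : ℝ)) (hp1 : (p : ℝ) < 1) (x : I) : 0 < ratio p x := by
  have := x.2.1; have := x.2.2
  unfold ratio
  rcases eq_or_lt_of_le (show 0 ≤ (x : ℝ) from x.2.1) with h | h
  · rw [← h]; linarith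
  · have h1 : (0 : ℝ) ≤ 1 - p := by linarith
    have h2 : (0 : ℝ) ≤ 1 - x := by linarith
    positivity

theorem measurable_ratio (p : I) : Measurable (ratio p) := by
  unfold ratio; fun_prop

theorem integral_fairArm (f : I → ℝ) :
    ∫ x, f x ∂(fairArm : Measure I) = (f 1 + f 0) / 2 := by
  have := integral_bernoulliMeasure (1 : I) 0 (⟨1 / 2, by norm_num, by norm_num⟩ : I) f
  simp only [fairArm, bernoulliArm, ProbabilityMeasure.coe_mk]
  rw [this]
  simp only [smul_eq_mul]
  ring

theorem lintegral_bernoulliArm (p : I) {f : I → ℝ≥0∞} (hf : Measurable f) :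
    ∫⁻ x, f x ∂(bernoulliArm p : Measure I) =
      ENNReal.ofReal p * f 1 + ENNReal.ofReal (1 - p) * f 0 := by
  have e1 : ∀ q : I, ((unitInterval.toNNReal q : NNReal) : ℝ≥0∞) = ENNReal.ofReal q := fun q =>
    (ENNReal.ofReal_eq_coe_nnreal q.2.1).symm
  have e2 : ENNReal.ofReal (1 - p) = ENNReal.ofReal (unitInterval.symm p : I) := rfl
  rw [e2, ← e1, ← e1]
  simp only [bernoulliArm, ProbabilityMeasure.coe_mk, bernoulliMeasure_def]
  rw [lintegral_add_measure, lintegral_smul_measure, lintegral_smul_measure,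
    lintegral_dirac' _ hf, lintegral_dirac' _ hf]
  rfl

theorem bernoulliArm_eq_withDensity (p : I) :
    (bernoulliArm p : Measure I) =
      (fairArm : Measure I).withDensity fun x => ENNReal.ofReal (ratio p x) := by
  have hm : Measurable fun x => ENNReal.ofReal (ratio p x) := (measurable_ratio p).ennreal_ofReal
  have hp : (0 : ℝ) ≤ 1 - p := by linarith [p.2.2]
  ext s hs
  rw [withDensity_apply _ hs, ← lintegral_indicator hs, fairArm,
    lintegral_bernoulliArm _ (hm.indicator hs), ← lintegral_indicator_one hs,
    lintegral_bernoulliArm _ (measurable_one.indicator hs)]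
  have h1 : ENNReal.ofReal p = ENNReal.ofReal (1 / 2) * ENNReal.ofReal (ratio p 1) := by
    rw [← ENNReal.ofReal_mul (by norm_num)]
    simp [ratio]
  have h0 : ENNReal.ofReal (1 - p) =
      ENNReal.ofReal (1 - 1 / 2) * ENNReal.ofReal (ratio p 0) := by
    rw [← ENNReal.ofReal_mul (by norm_num)]
    congr 1
    simp [ratio]
    ring
  rw [h1, h0]
  by_cases a1 : (1 : I) ∈ s <;> by_cases a0 : (0 : I) ∈ s <;> simp [a1, a0]

/-- The likelihood ratio, for the first `t` rounds, of `hardInstance n p i` and `nullInstance n`. -/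
def likelihood {n : ℕ} (p : I) (i : Fin n) (t : ℕ) (x : Rewards n) : ℝ :=
  ∏ s ∈ Finset.range t, ratio p (x s i)

theorem measurable_likelihood {n : ℕ} (p : I) (i : Fin n) (t : ℕ) :
    Measurable (likelihood p i t) := by
  unfold likelihood
  have := measurable_ratio p
  fun_prop

theorem likelihood_nonneg {n : ℕ} (p : I) (i : Fin n) (t : ℕ) (x : Rewards n) :
    0 ≤ likelihood p i t x :=
  Finset.prod_nonneg fun _ _ => ratio_nonneg _ _

theorem likelihood_le {n : ℕ} (p : I) (i : Fin n) (t : ℕ) (x : Rewards n) :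
    likelihood p i t x ≤ 2 ^ t := by
  have := Finset.prod_le_prod (s := Finset.range t) (f := fun s => ratio p (x s i))
    (g := fun _ => (2 : ℝ)) (fun _ _ => ratio_nonneg _ _) (fun _ _ => ratio_le_two _ _)
  simpa [likelihood] using this

theorem hardInstance_round (n : ℕ) (p : I) (i : Fin n) :
    (Measure.pi fun a => (hardInstance n p i a : Measure I)) =
      (Measure.pi fun a => (nullInstance n a : Measure I)).withDensity
        fun y => ENNReal.ofReal (ratio p (y i)) := by
  have h := pi_withDensity (fun a => (nullInstance n a : Measure I))
    (fun a => (hardInstance n p i a : Measure I))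
    (f := fun a y => if a = i then ENNReal.ofReal (ratio p y) else 1)
    (fun a => by
      by_cases h : a = i
      · simpa [h] using (measurable_ratio p).ennreal_ofReal
      · simp [h])
    (fun a => by
      by_cases h : a = i
      · simpa [h, hardInstance, nullInstance] using bernoulliArm_eq_withDensity p
      · simp [h, hardInstance, nullInstance, fairArm, ← Pi.one_def])
  rw [h]
  congr 1
  ext y
  simp

/-! ### Change of measure and independence over finitely many rounds -/

/-- `f` depends on the rewards of the rounds before `t` only. -/
def DependsBefore {n : ℕ} {β : Type*} (t : ℕ) (f : Rewards n → β) : Prop :=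
  ∀ x y, (∀ s < t, x s = y s) → f x = f y

/-- The reward table with the given first `t` rounds, and zeros afterwards. -/
def extend {n : ℕ} (t : ℕ) (z : ∀ _ : Finset.range t, Fin n → I) : Rewards n :=
  fun s => if h : s ∈ Finset.range t then z ⟨s, h⟩ else 0

theorem measurable_extend {n : ℕ} (t : ℕ) : Measurable (extend (n := n) t) := by
  refine measurable_pi_lambda _ fun s => ?_
  by_cases h : s ∈ Finset.range t
  · simpa only [extend, h, dite_true] using measurable_pi_apply _
  · simpa only [extend, h, dite_false] using measurable_const

theorem DependsBefore.extend_restrict {n : ℕ} {β : Type*} {t : ℕ} {f : Rewards n → β}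
    (hf : DependsBefore t f) (x : Rewards n) : f (extend t ((Finset.range t).restrict x)) = f x :=
  hf _ _ fun s hs => by simp [extend, hs]

instance (n : ℕ) (D : Bandit n) : IsProbabilityMeasure (rewardLaw D) := by
  unfold rewardLaw; infer_instance

/-- A function of the first `t` rounds factors through a finite product, on which the density of the
hard instance is the product of the densities of the rounds. -/
theorem integral_hardInstance {n : ℕ} (p : I) (i : Fin n) {t : ℕ} {f : Rewards n → ℝ}
    (hf : Measurable f) (hd : DependsBefore t f) :
    ∫ x, f x ∂rewardLaw (hardInstance n p i) =
      ∫ x, likelihood p i t x * f x ∂rewardLaw (nullInstance n) := by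
  have hl : DependsBefore t (likelihood (n := n) p i t) := fun x y h =>
    Finset.prod_congr rfl fun s hs => by rw [h s (Finset.mem_range.1 hs)]
  have hm := measurable_extend (n := n) t
  have hlm := measurable_likelihood p i t
  have e1 : ∀ x, f x = (fun z => f (extend t z)) ((Finset.range t).restrict x) := fun x =>
    (hd.extend_restrict x).symm
  have e2 : ∀ x, likelihood p i t x * f x =
      (fun z => likelihood p i t (extend t z) * f (extend t z)) ((Finset.range t).restrict x) :=
    fun x => by simp only [hd.extend_restrict, hl.extend_restrict]
  have key : ∀ (D : Bandit n) {g : (∀ _ : Finset.range t, Fin n → I) → ℝ}, Measurable g →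
      ∫ x, g ((Finset.range t).restrict x) ∂rewardLaw D =
        ∫ z, g z ∂Measure.pi fun _ : Finset.range t => Measure.pi fun a => (D a : Measure I) :=
    fun D g hg => integral_restrict_infinitePi
      (μ := fun _ : ℕ => Measure.pi fun a => (D a : Measure I)) hg.aestronglyMeasurable
  rw [integral_congr_ae (.of_forall e1), integral_congr_ae (.of_forall e2),
    key _ (g := fun z => f (extend t z)) (hf.comp hm),
    key _ (g := fun z => likelihood p i t (extend t z) * f (extend t z))
      ((hlm.comp hm).mul (hf.comp hm)),
    pi_withDensity (fun _ : Finset.range t => Measure.pi fun a => (nullInstance n a : Measure I))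
      (fun _ : Finset.range t => Measure.pi fun a => (hardInstance n p i a : Measure I))
      (f := fun _ y => ENNReal.ofReal (ratio p (y i)))
      (fun _ => ((measurable_ratio p).comp (measurable_pi_apply i)).ennreal_ofReal)
      (fun _ => hardInstance_round n p i)]
  have hr := measurable_ratio p
  rw [integral_withDensity_eq_integral_toReal_smul (by fun_prop)
    (.of_forall fun z => ENNReal.prod_lt_top fun _ _ => ENNReal.ofReal_lt_top)]
  refine integral_congr_ae (.of_forall fun z => ?_)
  simp only [ENNReal.toReal_prod, smul_eq_mul, ENNReal.toReal_ofReal (ratio_nonneg _ _)]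
  congr 1
  rw [likelihood, ← Finset.prod_coe_sort (Finset.range t)]
  refine Finset.prod_congr rfl fun s _ => ?_
  simp [extend]

theorem iIndepFun_rounds {n : ℕ} (D : Bandit n) :
    iIndepFun (fun (s : ℕ) (x : Rewards n) => x s) (rewardLaw D) :=
  iIndepFun_infinitePi (P := fun _ : ℕ => Measure.pi fun a => (D a : Measure I))
    (X := fun _ y => y) fun _ => measurable_id

theorem measurePreserving_round {n : ℕ} (D : Bandit n) (s : ℕ) :
    MeasurePreserving (fun x : Rewards n => x s) (rewardLaw D)
      (Measure.pi fun a => (D a : Measure I)) :=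
  measurePreserving_eval_infinitePi (fun _ : ℕ => Measure.pi fun a => (D a : Measure I)) s

theorem measurePreserving_reward {n : ℕ} (D : Bandit n) (s : ℕ) (i : Fin n) :
    MeasurePreserving (fun x : Rewards n => x s i) (rewardLaw D) (D i : Measure I) :=
  (measurePreserving_eval (fun a => (D a : Measure I)) i).comp (measurePreserving_round D s)

theorem integral_reward {n : ℕ} (D : Bandit n) (s : ℕ) (i : Fin n) {g : I → ℝ}
    (hg : Measurable g) :
    ∫ x, g (x s i) ∂rewardLaw D = ∫ y, g y ∂(D i : Measure I) := by
  rw [← (measurePreserving_reward D s i).map_eq,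
    integral_map (measurePreserving_reward D s i).measurable.aemeasurable hg.aestronglyMeasurable]

theorem integral_prod_rounds {n : ℕ} (D : Bandit n) (t : ℕ) {g : (Fin n → I) → ℝ}
    (hg : Measurable g) :
    ∫ x, ∏ s ∈ Finset.range t, g (x s) ∂rewardLaw D =
      (∫ y, g y ∂Measure.pi fun a => (D a : Measure I)) ^ t := by
  have hind : iIndepFun (fun (s : Fin t) (x : Rewards n) => g (x s)) (rewardLaw D) :=
    ((iIndepFun_rounds D).comp (fun _ => g) fun _ => hg).precomp Fin.val_injective
  have h := hind.integral_fun_prod_eq_prod_integral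
    fun s => (hg.comp (measurable_pi_apply (s : ℕ))).aestronglyMeasurable
  have e : ∀ x : Rewards n, ∏ s ∈ Finset.range t, g (x s) = ∏ s : Fin t, g (x s) := fun x =>
    (Fin.prod_univ_eq_prod_range (fun s => g (x s)) t).symm
  have e2 : ∀ s : Fin t, ∫ x, g (x s) ∂rewardLaw D =
      ∫ y, g y ∂Measure.pi fun a => (D a : Measure I) := fun s => by
    rw [← (measurePreserving_round D s).map_eq,
      integral_map (measurePreserving_round D s).measurable.aemeasurable hg.aestronglyMeasurable]
  simp only [e]
  rw [h]
  simp [e2]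

/-- The step behind Wald's identity: whether an arm is present in round `s` is decided before its
reward in round `s` is drawn. -/
theorem integral_mul_reward {n : ℕ} (D : Bandit n) {s : ℕ} (i : Fin n) {f : Rewards n → ℝ}
    (hf : Measurable f) (hd : DependsBefore s f) {g : I → ℝ} (hg : Measurable g) :
    ∫ x, f x * g (x s i) ∂rewardLaw D = (∫ x, f x ∂rewardLaw D) * ∫ y, g y ∂(D i : Measure I) := by
  have hind := (iIndepFun_rounds D).indepFun_finset (Finset.range s) {s} (by simp)
    fun i => measurable_pi_apply i
  have h2 := hind.comp (φ := fun z => f (extend s z))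
    (ψ := fun z => g (z ⟨s, Finset.mem_singleton_self s⟩ i))
    (hf.comp (measurable_extend s)) (by fun_prop)
  have e : ((fun z => f (extend s z)) ∘ fun (a : Rewards n) (i : Finset.range s) => a i) = f :=
    funext hd.extend_restrict
  rw [e] at h2
  rw [← integral_reward D s i hg]
  exact h2.integral_fun_mul_eq_mul_integral hf.aestronglyMeasurable
    (by fun_prop : Measurable _).aestronglyMeasurable

/-! ### Second moments of the likelihood ratios and transfer from the null instance -/

theorem integrable_of_bounded {Ω : Type*} [MeasurableSpace Ω] {μ : Measure Ω} [IsFiniteMeasure μ]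
    {f : Ω → ℝ} (hf : Measurable f) (C : ℝ) (hC : ∀ x, |f x| ≤ C) : Integrable f μ :=
  Integrable.of_bound hf.aestronglyMeasurable C (.of_forall hC)

theorem integral_ratio_fairArm (p : I) : ∫ y, ratio p y ∂(fairArm : Measure I) = 1 := by
  rw [integral_fairArm]; simp [ratio]; ring

theorem integral_ratio_mul_ratio {n : ℕ} (p : I) {i j : Fin n} (hij : i ≠ j) :
    ∫ y : Fin n → I, ratio p (y i) * ratio p (y j) ∂Measure.pi
      (fun a => (nullInstance n a : Measure I)) = 1 := by
  have hr := measurable_ratio p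
  have hind : iIndepFun (fun a (y : Fin n → I) => ratio p (y a))
      (Measure.pi fun a => (nullInstance n a : Measure I)) :=
    iIndepFun_pi (X := fun _ => ratio p) fun _ => hr.aemeasurable
  have hm : ∀ a : Fin n, ∫ y : Fin n → I, ratio p (y a) ∂Measure.pi
      (fun a => (nullInstance n a : Measure I)) = 1 := fun a => by
    have h := measurePreserving_eval (fun a => (nullInstance n a : Measure I)) a
    rw [← integral_ratio_fairArm p]
    change _ = ∫ y, ratio p y ∂(nullInstance n a : Measure I)
    rw [← h.map_eq, integral_map h.measurable.aemeasurable hr.aestronglyMeasurable]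
  have h := (hind.indepFun hij).integral_fun_mul_eq_mul_integral
    (by fun_prop : Measurable _).aestronglyMeasurable
    (by fun_prop : Measurable _).aestronglyMeasurable
  rw [h, hm, hm, one_mul]

theorem likelihood_mul {n : ℕ} (p : I) (i j : Fin n) (t : ℕ) (x : Rewards n) :
    likelihood p i t x * likelihood p j t x =
      ∏ s ∈ Finset.range t, ratio p (x s i) * ratio p (x s j) := by
  rw [Finset.prod_mul_distrib]; rfl

theorem integral_likelihood_mul_of_ne {n : ℕ} (p : I) {i j : Fin n} (hij : i ≠ j) (t : ℕ) :
    ∫ x, likelihood p i t x * likelihood p j t x ∂rewardLaw (nullInstance n) = 1 := by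
  have hr := measurable_ratio p
  simp only [likelihood_mul]
  rw [integral_prod_rounds (g := fun y => ratio p (y i) * ratio p (y j)) _ _ (by fun_prop),
    integral_ratio_mul_ratio p hij, one_pow]

theorem integral_likelihood {n : ℕ} (p : I) (i : Fin n) (t : ℕ) :
    ∫ x, likelihood p i t x ∂rewardLaw (nullInstance n) = 1 := by
  have h := integral_hardInstance p i (t := t) (f := fun _ => 1) measurable_const
    fun _ _ _ => rfl
  simpa using h.symm

theorem integrable_likelihood {n : ℕ} (p : I) (i : Fin n) (t : ℕ) (D : Bandit n) :
    Integrable (likelihood p i t) (rewardLaw D) :=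
  integrable_of_bounded (measurable_likelihood p i t) (2 ^ t) fun x => by
    rw [abs_of_nonneg (likelihood_nonneg ..)]; exact likelihood_le ..

theorem integrable_likelihood_mul {n : ℕ} (p : I) (i j : Fin n) (t : ℕ) (D : Bandit n) :
    Integrable (fun x => likelihood p i t x * likelihood p j t x) (rewardLaw D) :=
  integrable_of_bounded ((measurable_likelihood p i t).mul (measurable_likelihood p j t))
    (2 ^ t * 2 ^ t) fun x => by
    rw [abs_of_nonneg (mul_nonneg (likelihood_nonneg ..) (likelihood_nonneg ..))]
    exact mul_le_mul (likelihood_le ..) (likelihood_le ..) (likelihood_nonneg ..) (by positivity)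

theorem integral_likelihood_mul_self_le {n : ℕ} (p : I) (i : Fin n) (t : ℕ) :
    ∫ x, likelihood p i t x * likelihood p i t x ∂rewardLaw (nullInstance n) ≤ 2 ^ t := by
  calc ∫ x, likelihood p i t x * likelihood p i t x ∂rewardLaw (nullInstance n)
      ≤ ∫ x, 2 ^ t * likelihood p i t x ∂rewardLaw (nullInstance n) :=
        integral_mono (integrable_likelihood_mul ..) ((integrable_likelihood ..).const_mul _)
          fun x => mul_le_mul_of_nonneg_right (likelihood_le ..) (likelihood_nonneg ..)
    _ = 2 ^ t := by rw [integral_const_mul, integral_likelihood, mul_one]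

/-- Off-diagonal covariances vanish, so the variance is linear in `n` rather than quadratic. The
crude diagonal bound `2 ^ t` suffices because `t` is fixed before `n`. -/
theorem integral_sq_sum_likelihood_le (n : ℕ) (p : I) (t : ℕ) :
    ∫ x, (∑ i : Fin n, (likelihood p i t x - 1)) ^ 2 ∂rewardLaw (nullInstance n) ≤ n * 2 ^ t := by
  have hi : ∀ i j : Fin n, Integrable
      (fun x => (likelihood p i t x - 1) * (likelihood p j t x - 1))
      (rewardLaw (nullInstance n)) := fun i j => by
    have h := (((integrable_likelihood_mul p i j t (nullInstance n)).sub
      (integrable_likelihood p i t (nullInstance n))).sub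
      (integrable_likelihood p j t (nullInstance n))).add (integrable_const (1 : ℝ))
    refine h.congr (.of_forall fun x => ?_)
    simp only [Pi.add_apply, Pi.sub_apply]
    ring
  have hv : ∀ i j : Fin n, ∫ x, (likelihood p i t x - 1) * (likelihood p j t x - 1)
      ∂rewardLaw (nullInstance n) =
      ∫ x, likelihood p i t x * likelihood p j t x ∂rewardLaw (nullInstance n) - 1 := fun i j => by
    have e : ∀ x : Rewards n, (likelihood p i t x - 1) * (likelihood p j t x - 1) =
      likelihood p i t x * likelihood p j t x - likelihood p i t x - likelihood p j t x + 1 :=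
      fun x => by ring
    simp only [e]
    rw [integral_add, integral_sub, integral_sub, integral_likelihood, integral_likelihood]
    · simp
    · exact integrable_likelihood_mul ..
    · exact integrable_likelihood ..
    · exact (integrable_likelihood_mul ..).sub (integrable_likelihood ..)
    · exact integrable_likelihood ..
    · exact ((integrable_likelihood_mul ..).sub (integrable_likelihood ..)).sub
        (integrable_likelihood ..)
    · exact integrable_const _
  simp only [sq, Finset.sum_mul_sum]
  rw [integral_finsetSum _ fun i _ => integrable_finsetSum _ fun j _ => hi i j]
  calc _ = ∑ i : Fin n, ∑ j : Fin n, ∫ x, (likelihood p i t x - 1) * (likelihood p j t x - 1)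
        ∂rewardLaw (nullInstance n) :=
        Finset.sum_congr rfl fun i _ => integral_finsetSum _ fun j _ => hi i j
    _ ≤ ∑ i : Fin n, ∑ j : Fin n, if i = j then (2 : ℝ) ^ t else 0 := by
        refine Finset.sum_le_sum fun i _ => Finset.sum_le_sum fun j _ => ?_
        rw [hv]
        split_ifs with h
        · subst h; linarith [integral_likelihood_mul_self_le p i t]
        · rw [integral_likelihood_mul_of_ne p h, sub_self]
    _ = n * 2 ^ t := by simp

/-- A bounded function of the first `t` rounds has, on average over the position of the good arm,
nearly the same expectation on the hard instances as on the null instance. -/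
theorem sum_integral_hardInstance_ge {n : ℕ} (p : I) {t : ℕ} {Z : Rewards n → ℝ} {B : ℝ}
    (hZ : Measurable Z) (hd : DependsBefore t Z) (hB : ∀ x, |Z x| ≤ B) :
    n * ∫ x, Z x ∂rewardLaw (nullInstance n) - B * √(n * 2 ^ t) ≤
      ∑ i : Fin n, ∫ x, Z x ∂rewardLaw (hardInstance n p i) := by
  rcases Nat.eq_zero_or_pos n with rfl | hn
  · simp
  set μ := rewardLaw (nullInstance n)
  set W : Rewards n → ℝ := fun x => ∑ i : Fin n, (likelihood p i t x - 1) with hW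
  set c : ℝ := √(n * 2 ^ t) with hc
  have hc0 : 0 < c := Real.sqrt_pos.2 (by positivity)
  have hc2 : c ^ 2 = n * 2 ^ t := Real.sq_sqrt (by positivity)
  have hZi : Integrable Z μ := integrable_of_bounded hZ B hB
  have hB0 : 0 ≤ B := (abs_nonneg _).trans (hB fun _ _ => 0)
  have hLi : ∀ i : Fin n, Integrable (fun x => likelihood p i t x * Z x) μ := fun i =>
    integrable_of_bounded ((measurable_likelihood p i t).mul hZ) (2 ^ t * B) fun x => by
      rw [abs_mul, abs_of_nonneg (likelihood_nonneg ..)]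
      exact mul_le_mul (likelihood_le ..) (hB x) (abs_nonneg _) (by positivity)
  have hWm : Measurable W := by
    have := fun i : Fin n => measurable_likelihood p i t
    fun_prop
  have hWb : ∀ x, |W x| ≤ n * 2 ^ t := fun x => by
    refine (Finset.abs_sum_le_sum_abs _ _).trans ?_
    refine (Finset.sum_le_sum (g := fun _ => (2 : ℝ) ^ t) fun i _ => ?_).trans (by simp)
    have h1 := likelihood_nonneg p i t x
    have h2 := likelihood_le p i t x
    have h3 : (1 : ℝ) ≤ 2 ^ t := one_le_pow₀ (by norm_num)
    rw [abs_le]; constructor <;> linarith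
  have hW2 : Integrable (fun x => W x ^ 2) μ :=
    integrable_of_bounded (hWm.pow_const 2) ((n * 2 ^ t) ^ 2) fun x => by
      rw [abs_pow]; exact pow_le_pow_left₀ (abs_nonneg _) (hWb x) 2
  have e1 : ∑ i : Fin n, ∫ x, Z x ∂rewardLaw (hardInstance n p i) =
      ∫ x, (∑ i : Fin n, likelihood p i t x * Z x) ∂μ := by
    rw [integral_finsetSum _ fun i _ => hLi i]
    exact Finset.sum_congr rfl fun i _ => integral_hardInstance p i hZ hd
  -- The inequality `|W| ≤ (W²/c + c)/2` replaces Cauchy–Schwarz; `c` is the bound on the L² norm of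
  -- `W`, which balances the two terms.
  have hlow : ∀ x, n * Z x - B * ((W x ^ 2 / c + c) / 2) ≤ ∑ i : Fin n, likelihood p i t x * Z x := by
    intro x
    have e : ∑ i : Fin n, likelihood p i t x * Z x = n * Z x + W x * Z x := by
      rw [hW, ← Finset.sum_mul]
      simp only [Finset.sum_sub_distrib, Finset.sum_const, Finset.card_univ, Fintype.card_fin,
        nsmul_eq_mul, mul_one]
      ring
    rw [e]
    have h1 : |W x| ≤ (W x ^ 2 / c + c) / 2 := by
      have : W x ^ 2 / c + c - 2 * |W x| = (|W x| - c) ^ 2 / c := by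
        rw [← sq_abs (W x)]; field_simp; ring
      have : 0 ≤ (|W x| - c) ^ 2 / c := by positivity
      linarith
    have h2 : |W x * Z x| ≤ ((W x ^ 2 / c + c) / 2) * B := by
      rw [abs_mul]
      exact mul_le_mul h1 (hB x) (abs_nonneg _) (by positivity)
    have := neg_abs_le (W x * Z x)
    linarith
  have hint : Integrable (fun x => B * ((W x ^ 2 / c + c) / 2)) μ :=
    (((hW2.div_const c).add (integrable_const c)).div_const 2).const_mul B
  have hmono := integral_mono ((hZi.const_mul (n : ℝ)).sub hint)
    (integrable_finsetSum Finset.univ fun i _ => hLi i) hlow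
  simp only [Pi.sub_apply] at hmono
  rw [integral_sub (hZi.const_mul _) hint, integral_const_mul, integral_const_mul,
    integral_div, integral_add (hW2.div_const c) (integrable_const c), integral_div,
    integral_const, probReal_univ, one_smul] at hmono
  rw [e1]
  have h3 : (∫ x, W x ^ 2 ∂μ) / c ≤ c := by
    rw [div_le_iff₀ hc0, ← sq, hc2]
    exact integral_sq_sum_likelihood_le n p t
  have h4 : B * (((∫ x, W x ^ 2 ∂μ) / c + c) / 2) ≤ B * c :=
    mul_le_mul_of_nonneg_left (by linarith) hB0
  linarith

/-! ### Relative entropy and stopped sums -/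

/-- The relative entropy of a fair coin with respect to a Bernoulli reward of mean `p`. -/
noncomputable def entropy (p : I) : ℝ := -(Real.log (2 * p) + Real.log (2 * (1 - p))) / 2

theorem integral_log_ratio (p : I) :
    ∫ y, Real.log (ratio p y) ∂(fairArm : Measure I) = -entropy p := by
  rw [integral_fairArm]; simp [ratio, entropy]; ring

theorem abs_log_ratio_le {p : I} (hp0 : 1 / 2 ≤ (p : ℝ)) (hp1 : (p : ℝ) < 1) (y : I) :
    |Real.log (ratio p y)| ≤ |Real.log (2 * (1 - p))| + Real.log 2 := by
  have hpos := ratio_pos (by linarith) hp1 y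
  have hlow : 2 * (1 - (p : ℝ)) ≤ ratio p y := by
    have := y.2.1
    unfold ratio
    nlinarith
  have h1 := Real.log_le_log (by linarith) hlow
  have h2 := Real.log_le_log hpos (ratio_le_two p y)
  have h3 := Real.log_nonneg (show (1 : ℝ) ≤ 2 by norm_num)
  have h4 := neg_abs_le (Real.log (2 * (1 - (p : ℝ))))
  rw [abs_le]
  constructor
  · linarith
  · linarith [abs_nonneg (Real.log (2 * (1 - (p : ℝ))))]

theorem likelihood_pos {n : ℕ} {p : I} (hp0 : 0 < (p : ℝ)) (hp1 : (p : ℝ) < 1) (i : Fin n) (t : ℕ)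
    (x : Rewards n) : 0 < likelihood p i t x :=
  Finset.prod_pos fun _ _ => ratio_pos hp0 hp1 _

theorem DependsBefore.comp {n t : ℕ} {β γ : Type*} {f : Rewards n → β} (hf : DependsBefore t f)
    (g : β → γ) : DependsBefore t fun x => g (f x) :=
  fun x y h => congrArg g (hf x y h)

theorem DependsBefore.mono {n s t : ℕ} {β : Type*} {f : Rewards n → β} (hf : DependsBefore s f)
    (hst : s ≤ t) : DependsBefore t f :=
  fun x y h => hf x y fun u hu => h u (hu.trans_le hst)

/-- Summation by parts: a sum of increments stopped at a random time, evaluated at that time. -/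
theorem sum_stopped_increments (a l : ℕ → ℝ) (t : ℕ) :
    ∑ s ∈ Finset.range t, a s * l s =
      ∑ s ∈ Finset.range t, (a s - a (s + 1)) * ∑ u ∈ Finset.range (s + 1), l u +
        a t * ∑ u ∈ Finset.range t, l u := by
  induction t with
  | zero => simp
  | succ t ih =>
    rw [Finset.sum_range_succ, ih, Finset.sum_range_succ _ t]
    rw [Finset.sum_range_succ l t]
    ring

/-! ### The likelihood ratio of an arm, stopped when the arm is discarded -/

namespace EliminationAlgorithm

variable {n : ℕ} {R : Type*} [MeasurableSpace R]

theorem surv_dependsBefore (A : EliminationAlgorithm n R) (t : ℕ) (r : R) :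
    DependsBefore t (A.surv t r) := by
  intro x y h
  cases t with
  | zero => rw [A.surv_zero, A.surv_zero]
  | succ t => exact A.surv_succ_congr t r x y fun s hs a _ => by rw [h s (Nat.lt_succ_of_le hs)]

theorem surv_antitone (A : EliminationAlgorithm n R) (r : R) (x : Rewards n) :
    Antitone fun t => A.surv t r x :=
  antitone_nat_of_succ_le fun t => A.surv_succ_subset t r x

/-- The indicator of the event that arm `i` is present in round `t`. -/
def present (A : EliminationAlgorithm n R) (i : Fin n) (t : ℕ) (r : R) (x : Rewards n) : ℝ :=
  if i ∈ A.surv t r x then 1 else 0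

theorem present_nonneg (A : EliminationAlgorithm n R) (i : Fin n) (t : ℕ) (r : R)
    (x : Rewards n) : 0 ≤ A.present i t r x := by
  unfold present; split_ifs <;> norm_num

theorem present_le_one (A : EliminationAlgorithm n R) (i : Fin n) (t : ℕ) (r : R)
    (x : Rewards n) : A.present i t r x ≤ 1 := by
  unfold present; split_ifs <;> norm_num

theorem abs_present_le_one (A : EliminationAlgorithm n R) (i : Fin n) (t : ℕ) (r : R)
    (x : Rewards n) : |A.present i t r x| ≤ 1 := by
  rw [abs_of_nonneg (A.present_nonneg ..)]; exact A.present_le_one ..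

theorem present_zero (A : EliminationAlgorithm n R) (i : Fin n) (r : R) (x : Rewards n) :
    A.present i 0 r x = 1 := by
  simp [present, A.surv_zero]

theorem present_antitone (A : EliminationAlgorithm n R) (i : Fin n) (r : R) (x : Rewards n) :
    Antitone fun t => A.present i t r x := by
  intro s t hst
  by_cases h : i ∈ A.surv t r x
  · simp [present, h, A.surv_antitone r x hst h]
  · simpa [present, h] using A.present_nonneg i s r x

theorem measurable_present_uncurry (A : EliminationAlgorithm n R) (i : Fin n) (t : ℕ) :
    Measurable fun q : R × Rewards n => A.present i t q.1 q.2 :=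
  Measurable.ite (A.measurable_surv t i) measurable_const measurable_const

theorem measurable_present (A : EliminationAlgorithm n R) (i : Fin n) (t : ℕ) (r : R) :
    Measurable (A.present i t r) :=
  (A.measurable_present_uncurry i t).comp measurable_prodMk_left

theorem present_dependsBefore (A : EliminationAlgorithm n R) (i : Fin n) (t : ℕ) (r : R) :
    DependsBefore t (A.present i t r) :=
  (A.surv_dependsBefore t r).comp fun S => if i ∈ S then 1 else 0

theorem integrable_present (A : EliminationAlgorithm n R) (i : Fin n) (t : ℕ) (r : R)
    (D : Bandit n) : Integrable (A.present i t r) (rewardLaw D) :=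
  integrable_of_bounded (A.measurable_present i t r) 1 (A.abs_present_le_one i t r)

/-- The left side is `log L` at the time when arm `i` is discarded, or at `t` if it is kept. The
bound `log y ≤ y - 1` is used with `y = L/δ` in the first case and with `y = L` in the second. It is
linear in `L`, so integration under the null turns it into probabilities on the hard instance. -/
theorem sum_present_mul_log_le (A : EliminationAlgorithm n R) {p : I} (hp0 : 0 < (p : ℝ))
    (hp1 : (p : ℝ) < 1) (i : Fin n) (t : ℕ) {δ : ℝ} (hδ : 0 < δ) (r : R) (x : Rewards n) :
    ∑ s ∈ Finset.range t, A.present i s r x * Real.log (ratio p (x s i)) ≤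
      ∑ s ∈ Finset.range t, (likelihood p i (s + 1) x *
          (A.present i s r x - A.present i (s + 1) r x) * δ⁻¹ -
        (1 + Real.log (1 / δ)) * (A.present i s r x - A.present i (s + 1) r x)) +
      (likelihood p i t x * A.present i t r x - A.present i t r x) := by
  have hlog : ∀ m, ∑ u ∈ Finset.range m, Real.log (ratio p (x u i)) =
      Real.log (likelihood p i m x) := fun m =>
    (Real.log_prod fun u _ => (ratio_pos hp0 hp1 (x u i)).ne').symm
  rw [sum_stopped_increments (fun s => A.present i s r x)]
  simp only [hlog]
  refine add_le_add (Finset.sum_le_sum fun s _ => ?_) ?_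
  · have h1 : 0 ≤ A.present i s r x - A.present i (s + 1) r x :=
      sub_nonneg.2 (A.present_antitone i r x (Nat.le_succ s))
    have hL := likelihood_pos hp0 hp1 i (s + 1) x
    have h2 := Real.log_le_sub_one_of_pos (mul_pos hL (inv_pos.2 hδ))
    rw [Real.log_mul hL.ne' (inv_pos.2 hδ).ne'] at h2
    rw [one_div]
    nlinarith
  · have h2 := Real.log_le_sub_one_of_pos (likelihood_pos hp0 hp1 i t x)
    nlinarith [A.present_nonneg i t r x]

/-- A change of measure: if the good arm `i` is rarely discarded, then arm `i` is pulled often on the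
null instance, unless it is rarely discarded there as well. -/
theorem entropy_mul_pulls_ge (A : EliminationAlgorithm n R) {p : I} (hp0 : 1 / 2 ≤ (p : ℝ))
    (hp1 : (p : ℝ) < 1) (i : Fin n) (t : ℕ) {δ : ℝ} (hδ : 0 < δ) (r : R) :
    (1 - ∫ x, A.present i t r x ∂rewardLaw (nullInstance n)) * Real.log (1 / δ) -
        (1 - ∫ x, A.present i t r x ∂rewardLaw (hardInstance n p i)) / δ ≤
      entropy p * ∑ s ∈ Finset.range t, ∫ x, A.present i s r x ∂rewardLaw (nullInstance n) := by
  have hpos : 0 < (p : ℝ) := by linarith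
  set μ := rewardLaw (nullInstance n)
  set ν := rewardLaw (hardInstance n p i)
  have hr := measurable_ratio p
  have ha : ∀ s (D : Bandit n), Integrable (A.present i s r) (rewardLaw D) := fun s D =>
    A.integrable_present i s r D
  have hdiff : ∀ s, Measurable fun x => A.present i s r x - A.present i (s + 1) r x := fun s =>
    (A.measurable_present i s r).sub (A.measurable_present i (s + 1) r)
  have hdd : ∀ s, DependsBefore (s + 1)
      fun x => A.present i s r x - A.present i (s + 1) r x := fun s x y h => by
    simp only [(A.present_dependsBefore i s r).mono s.le_succ x y h,
      A.present_dependsBefore i (s + 1) r x y h]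
  have hdi : ∀ s, Integrable (fun x => A.present i s r x - A.present i (s + 1) r x) μ := fun s =>
    (ha s _).sub (ha (s + 1) _)
  have hLbd : ∀ s {f : Rewards n → ℝ}, Measurable f → (∀ x, |f x| ≤ 1) →
      Integrable (fun x => likelihood p i s x * f x) μ := fun s f hf hb =>
    integrable_of_bounded ((measurable_likelihood p i s).mul hf) (2 ^ s * 1) fun x => by
      rw [abs_mul, abs_of_nonneg (likelihood_nonneg ..)]
      exact mul_le_mul (likelihood_le ..) (hb x) (abs_nonneg _) (by positivity)
  have hLd : ∀ s, Integrable (fun x => likelihood p i (s + 1) x *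
      (A.present i s r x - A.present i (s + 1) r x)) μ := fun s =>
    hLbd (s + 1) (hdiff s) fun x => by
      have h1 := A.present_nonneg i s r x
      have h2 := A.present_nonneg i (s + 1) r x
      have h3 := A.present_le_one i s r x
      have h4 := A.present_le_one i (s + 1) r x
      rw [abs_le]; constructor <;> linarith
  have hLt := hLbd t (A.measurable_present i t r) (A.abs_present_le_one i t r)
  have hlog : ∀ s, Integrable (fun x => A.present i s r x * Real.log (ratio p (x s i))) μ :=
    fun s => by
    have hm := A.measurable_present i s r
    refine integrable_of_bounded (by fun_prop) (1 * (|Real.log (2 * (1 - p))| + Real.log 2))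
      fun x => ?_
    rw [abs_mul]
    exact mul_le_mul (A.abs_present_le_one i s r x) (abs_log_ratio_le hp0 hp1 _) (abs_nonneg _)
      zero_le_one
  have hsum : ∀ s, Integrable (fun x => likelihood p i (s + 1) x *
      (A.present i s r x - A.present i (s + 1) r x) * δ⁻¹ -
      (1 + Real.log (1 / δ)) * (A.present i s r x - A.present i (s + 1) r x)) μ := fun s =>
    ((hLd s).mul_const δ⁻¹).sub ((hdi s).const_mul _)
  have hsums := integrable_finsetSum (Finset.range t) fun s _ => hsum s
  have hend : Integrable (fun x => likelihood p i t x * A.present i t r x - A.present i t r x) μ :=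
    hLt.sub (ha t _)
  have hmono := integral_mono (integrable_finsetSum (Finset.range t) fun s _ => hlog s)
    (hsums.add hend) fun x => A.sum_present_mul_log_le hpos hp1 i t hδ r x
  simp only [Pi.add_apply] at hmono
  rw [integral_finsetSum _ fun s _ => hlog s, integral_add hsums hend,
    integral_finsetSum _ fun s _ => hsum s, integral_sub hLt (ha t _)] at hmono
  have e1 : ∀ s, ∫ x, A.present i s r x * Real.log (ratio p (x s i)) ∂μ =
      (∫ x, A.present i s r x ∂μ) * -entropy p := fun s => by
    rw [← integral_log_ratio p]
    exact integral_mul_reward (nullInstance n) i (A.measurable_present i s r)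
      (A.present_dependsBefore i s r) (g := fun y => Real.log (ratio p y)) (by fun_prop)
  have e2 : ∀ s, ∫ x, (likelihood p i (s + 1) x *
        (A.present i s r x - A.present i (s + 1) r x) * δ⁻¹ -
        (1 + Real.log (1 / δ)) * (A.present i s r x - A.present i (s + 1) r x)) ∂μ =
      (∫ x, A.present i s r x ∂ν - ∫ x, A.present i (s + 1) r x ∂ν) * δ⁻¹ -
      (1 + Real.log (1 / δ)) * (∫ x, A.present i s r x ∂μ - ∫ x, A.present i (s + 1) r x ∂μ) :=
    fun s => by
    rw [integral_sub ((hLd s).mul_const _) ((hdi s).const_mul _), integral_mul_const,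
      integral_const_mul, ← integral_hardInstance p i (hdiff s) (hdd s),
      integral_sub (ha s _) (ha (s + 1) _), integral_sub (ha s _) (ha (s + 1) _)]
  have e3 : ∫ x, likelihood p i t x * A.present i t r x ∂μ = ∫ x, A.present i t r x ∂ν :=
    (integral_hardInstance p i (A.measurable_present i t r) (A.present_dependsBefore i t r)).symm
  have e0 : ∀ D : Bandit n, ∫ x, A.present i 0 r x ∂rewardLaw D = 1 := fun D => by
    simp [A.present_zero]
  simp only [e1, e2, e3] at hmono
  rw [← Finset.sum_mul, Finset.sum_sub_distrib, ← Finset.sum_mul, ← Finset.mul_sum,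
    Finset.sum_range_sub' (fun s => ∫ x, A.present i s r x ∂ν),
    Finset.sum_range_sub' (fun s => ∫ x, A.present i s r x ∂μ), e0, e0] at hmono
  -- The constant terms of the two uses of `log y ≤ y - 1` leave exactly this integral minus `1`,
  -- which can be dropped.
  have h1 : ∫ x, A.present i t r x ∂ν ≤ 1 := by
    have := integral_mono (ha t (hardInstance n p i)) (integrable_const 1)
      (A.present_le_one i t r)
    simpa using this
  rw [div_eq_mul_inv (1 - _) δ]
  linarith

theorem pulls_ge (A : EliminationAlgorithm n R) (D : Bandit n) (i : Fin n) (t : ℕ) (r : R) :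
    t * ∫ x, A.present i t r x ∂rewardLaw D ≤
      ∑ s ∈ Finset.range t, ∫ x, A.present i s r x ∂rewardLaw D := by
  have := Finset.sum_le_sum fun s (hs : s ∈ Finset.range t) =>
    integral_mono (A.integrable_present i t r D) (A.integrable_present i s r D)
      fun x => A.present_antitone i r x (Finset.mem_range.1 hs).le
  simpa using this

/-! ### Counting pulls up to the horizon -/

/-- The number of pulls in the first `t` rounds, reduced by one pull per round. -/
def excess (A : EliminationAlgorithm n R) (t : ℕ) (r : R) (x : Rewards n) : ℝ :=
  ∑ s ∈ Finset.range t, (∑ i, A.present i s r x - 1)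

theorem sum_present (A : EliminationAlgorithm n R) (s : ℕ) (r : R) (x : Rewards n) :
    ∑ i, A.present i s r x = (A.surv s r x).card := by
  simp [present]

theorem measurable_excess_uncurry (A : EliminationAlgorithm n R) (t : ℕ) :
    Measurable fun q : R × Rewards n => A.excess t q.1 q.2 := by
  have := A.measurable_present_uncurry
  unfold excess
  fun_prop

theorem measurable_excess (A : EliminationAlgorithm n R) (t : ℕ) (r : R) :
    Measurable (A.excess t r) := by
  have := fun i s => A.measurable_present i s r
  change Measurable fun x => ∑ s ∈ Finset.range t, (∑ i, A.present i s r x - 1)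
  fun_prop

theorem excess_dependsBefore (A : EliminationAlgorithm n R) (t : ℕ) (r : R) :
    DependsBefore t (A.excess t r) := fun x y h => by
  refine Finset.sum_congr rfl fun s hs => ?_
  have := fun i => (A.present_dependsBefore i s r).mono (Finset.mem_range.1 hs).le x y h
  simp only [this]

theorem one_le_card_surv (A : EliminationAlgorithm n R) (hn : 0 < n) (t : ℕ) (r : R)
    (x : Rewards n) : (1 : ℝ) ≤ (A.surv t r x).card := by
  exact_mod_cast (A.surv_nonempty t r x hn).card_pos

theorem excess_nonneg (A : EliminationAlgorithm n R) (hn : 0 < n) (t : ℕ) (r : R)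
    (x : Rewards n) : 0 ≤ A.excess t r x :=
  Finset.sum_nonneg fun s _ => by
    rw [A.sum_present]; linarith [A.one_le_card_surv hn s r x]

theorem abs_excess_le (A : EliminationAlgorithm n R) (hn : 0 < n) (t : ℕ) (r : R)
    (x : Rewards n) : |A.excess t r x| ≤ n * t := by
  rw [abs_of_nonneg (A.excess_nonneg hn t r x)]
  refine (Finset.sum_le_sum (g := fun _ => (n : ℝ)) fun s _ => ?_).trans (by simp [mul_comm])
  rw [A.sum_present]
  have : ((A.surv s r x).card : ℝ) ≤ n := by
    exact_mod_cast (Finset.card_le_univ _).trans_eq (Fintype.card_fin n)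
  linarith

theorem integral_excess (A : EliminationAlgorithm n R) (t : ℕ) (r : R) (D : Bandit n) :
    ∫ x, A.excess t r x ∂rewardLaw D =
      ∑ i, ∑ s ∈ Finset.range t, ∫ x, A.present i s r x ∂rewardLaw D - t := by
  have ha := fun i s => A.integrable_present i s r D
  have hs : ∀ s, Integrable (fun x => ∑ i, A.present i s r x) (rewardLaw D) := fun s =>
    integrable_finsetSum _ fun i _ => ha i s
  have h1 : ∀ s, Integrable (fun x => ∑ i, A.present i s r x - 1) (rewardLaw D) := fun s =>
    (hs s).sub (integrable_const 1)
  have h2 : ∀ s, ∫ x, (∑ i, A.present i s r x - 1) ∂rewardLaw D =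
      ∑ i, ∫ x, A.present i s r x ∂rewardLaw D - 1 := fun s => by
    rw [integral_sub (hs s) (integrable_const 1), integral_finsetSum _ fun i _ => ha i s]
    simp
  unfold excess
  rw [integral_finsetSum _ fun s _ => h1 s]
  simp only [h2]
  rw [Finset.sum_sub_distrib, Finset.sum_comm]
  simp

/-- After termination the single remaining arm stays in `surv` but is no longer pulled. Subtracting
one per round makes those rounds contribute zero, at a total cost of only `t`. -/
theorem ofReal_excess_le_queries (A : EliminationAlgorithm n R) (hn : 0 < n) (t : ℕ) (r : R)
    (x : Rewards n) : ENNReal.ofReal (A.excess t r x) ≤ A.queries r x := by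
  unfold excess queries
  rw [ENNReal.ofReal_sum_of_nonneg fun s _ => by
    rw [A.sum_present]; linarith [A.one_le_card_surv hn s r x]]
  refine le_trans (Finset.sum_le_sum fun s _ => ?_) (ENNReal.sum_le_tsum (Finset.range t))
  rw [A.sum_present]
  split_ifs with h
  · rw [← ENNReal.ofReal_natCast]
    exact ENNReal.ofReal_le_ofReal (by linarith)
  · have h1 : (A.surv s r x).card ≤ 1 := by
      by_contra h2; exact h (Or.inr (not_le.1 h2))
    have : ((A.surv s r x).card : ℝ) ≤ 1 := by exact_mod_cast h1
    simp [this]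

/-- The failure probability is controlled only on average over the internal randomness, not for each
`r`. The bound is therefore kept affine in it, ready to be integrated over `r`. -/
theorem sum_integral_excess_ge (A : EliminationAlgorithm n R) (hn : 0 < n) {p : I}
    (hp0 : 1 / 2 ≤ (p : ℝ)) (hp1 : (p : ℝ) < 1) (hk : 0 < entropy p) (t : ℕ) {δ : ℝ} (hδ : 0 < δ)
    {c : ℝ} (hc0 : 0 ≤ c) (hc1 : c ≤ 1)
    (ht : (1 - c) * Real.log (1 / δ) ≤ c * (t * entropy p)) (r : R) :
    n * (∑ i, (1 - c) / entropy p * (Real.log (1 / δ) -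
        (1 - ∫ x, A.present i t r x ∂rewardLaw (hardInstance n p i)) / δ) - t) -
        n * t * √(n * 2 ^ t) ≤
      ∑ i, ∫ x, A.excess t r x ∂rewardLaw (hardInstance n p i) := by
  refine le_trans ?_ (sum_integral_hardInstance_ge p (A.measurable_excess t r)
    (A.excess_dependsBefore t r) (A.abs_excess_le hn t r))
  rw [A.integral_excess]
  gcongr with i
  have h1 := A.entropy_mul_pulls_ge hp0 hp1 i t hδ r
  have h2 := A.pulls_ge (nullInstance n) i t r
  set T := ∑ s ∈ Finset.range t, ∫ x, A.present i s r x ∂rewardLaw (nullInstance n)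
  set q := ∫ x, A.present i t r x ∂rewardLaw (nullInstance n)
  set w := (1 - ∫ x, A.present i t r x ∂rewardLaw (hardInstance n p i)) / δ
  have hq : 0 ≤ q := integral_nonneg fun x => A.present_nonneg i t r x
  rw [div_mul_eq_mul_div, div_le_iff₀ hk]
  -- Weight `1 - c` goes to the change of measure and weight `c` to the pulls of an arm kept for `t`
  -- rounds. By `ht` the latter makes up for the `q * log (1 / δ)` missing from the former, whatever
  -- `q` is.
  have h3 := mul_le_mul_of_nonneg_left h1 (sub_nonneg.2 hc1)
  have h4 := mul_le_mul_of_nonneg_left h2 (mul_nonneg hc0 hk.le)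
  have h5 := mul_le_mul_of_nonneg_left ht hq
  nlinarith

end EliminationAlgorithm

/-! ### Averaging over the internal randomness and over the good arm -/

namespace EliminationAlgorithm

variable {n : ℕ} {R : Type*} [MeasurableSpace R]

/-- After termination the sets stay nonempty and can only shrink, hence remain the same singleton.
-/
theorem mem_surv_of_returns (A : EliminationAlgorithm n R) {i : Fin n} {r : R} {x : Rewards n}
    (h : A.Returns i r x) (t : ℕ) : i ∈ A.surv t r x := by
  obtain ⟨s, -, hs⟩ := h
  rcases le_total t s with hts | hts
  · exact A.surv_antitone r x hts (show i ∈ A.surv s r x by simp [hs])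
  · obtain ⟨j, hj⟩ := A.surv_nonempty t r x i.pos
    have hji : j ∈ A.surv s r x := A.surv_antitone r x hts hj
    rw [hs, Finset.mem_singleton] at hji
    exact hji ▸ hj

theorem integrable_present_prod (A : EliminationAlgorithm n R) (i : Fin n) (t : ℕ)
    (ρ : Measure R) [IsProbabilityMeasure ρ] (D : Bandit n) :
    Integrable (fun q : R × Rewards n => A.present i t q.1 q.2) (ρ.prod (rewardLaw D)) :=
  integrable_of_bounded (A.measurable_present_uncurry i t) 1 fun q =>
    A.abs_present_le_one i t q.1 q.2

theorem le_integral_present (A : EliminationAlgorithm n R) (ρ : Measure R)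
    [IsProbabilityMeasure ρ] (D : Bandit n) (i : Fin n) (t : ℕ) {δ : ℝ}
    (h : ENNReal.ofReal (1 - δ) ≤ A.probReturns ρ D fun a => a = i) :
    1 - δ ≤ ∫ r, ∫ x, A.present i t r x ∂rewardLaw D ∂ρ := by
  rw [← integral_prod (fun q : R × Rewards n => A.present i t q.1 q.2)
    (A.integrable_present_prod i t ρ D)]
  have e : (fun q : R × Rewards n => A.present i t q.1 q.2) =
      {q : R × Rewards n | i ∈ A.surv t q.1 q.2}.indicator 1 := by
    ext q
    simp [present, Set.indicator_apply]
  rw [e, integral_indicator_one (A.measurable_surv t i)]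
  refine (ENNReal.ofReal_le_iff_le_toReal (measure_ne_top _ _)).1 (h.trans (measure_mono ?_))
  rintro q ⟨a, rfl, ha⟩
  exact A.mem_surv_of_returns ha t

theorem exists_le_expectedQueries (A : EliminationAlgorithm n R) (ρ : Measure R)
    [IsProbabilityMeasure ρ] (hn : 0 < n) {p : I} (hp0 : 1 / 2 ≤ (p : ℝ)) (hp1 : (p : ℝ) < 1)
    (hk : 0 < entropy p) (t : ℕ) {δ : ℝ} (hδ : 0 < δ) {c : ℝ} (hc0 : 0 ≤ c) (hc1 : c ≤ 1)
    (ht : (1 - c) * Real.log (1 / δ) ≤ c * (t * entropy p))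
    (hA : ∀ i, ENNReal.ofReal (1 - δ) ≤ A.probReturns ρ (hardInstance n p i) fun a => a = i) :
    ∃ i, ENNReal.ofReal (n * ((1 - c) / entropy p * (Real.log (1 / δ) - 1)) - t -
      t * √(n * 2 ^ t)) ≤ A.expectedQueries ρ (hardInstance n p i) := by
  set X := n * ((1 - c) / entropy p * (Real.log (1 / δ) - 1)) - t - t * √(n * 2 ^ t) with hX
  have hint : ∀ i, Integrable (fun q : R × Rewards n => A.excess t q.1 q.2)
      (ρ.prod (rewardLaw (hardInstance n p i))) := fun i =>
    integrable_of_bounded (A.measurable_excess_uncurry t) _ fun q => A.abs_excess_le hn t q.1 q.2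
  have hpi : ∀ i, Integrable
      (fun r => ∫ x, A.present i t r x ∂rewardLaw (hardInstance n p i)) ρ := fun i =>
    (A.integrable_present_prod i t ρ _).integral_prod_left
  have hterm : ∀ i, Integrable (fun r => (1 - c) / entropy p * (Real.log (1 / δ) -
      (1 - ∫ x, A.present i t r x ∂rewardLaw (hardInstance n p i)) / δ)) ρ := fun i =>
    ((integrable_const _).sub (((integrable_const 1).sub (hpi i)).div_const δ)).const_mul _
  have hsum := integrable_finsetSum Finset.univ fun i _ => hterm i
  have hmain : Integrable (fun r => n * (∑ i, (1 - c) / entropy p * (Real.log (1 / δ) -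
      (1 - ∫ x, A.present i t r x ∂rewardLaw (hardInstance n p i)) / δ) - t)) ρ :=
    (hsum.sub (integrable_const (t : ℝ))).const_mul _
  have h := integral_mono (hmain.sub (integrable_const (n * t * √(n * 2 ^ t))))
    (integrable_finsetSum Finset.univ fun i _ => (hint i).integral_prod_left)
    fun r => A.sum_integral_excess_ge hn hp0 hp1 hk t hδ hc0 hc1 ht r
  simp only [Pi.sub_apply] at h
  rw [integral_sub hmain (integrable_const _), integral_const_mul,
    integral_sub hsum (integrable_const _), integral_finsetSum _ fun i _ => hterm i,
    integral_finsetSum _ fun i _ => (hint i).integral_prod_left] at h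
  have hw : ∀ i, (1 - c) / entropy p * (Real.log (1 / δ) - 1) ≤
      ∫ r, (1 - c) / entropy p * (Real.log (1 / δ) -
        (1 - ∫ x, A.present i t r x ∂rewardLaw (hardInstance n p i)) / δ) ∂ρ := fun i => by
    have hdiv : Integrable (fun r => (1 - ∫ x, A.present i t r x
        ∂rewardLaw (hardInstance n p i)) / δ) ρ :=
      ((integrable_const 1).sub (hpi i)).div_const δ
    rw [integral_const_mul, integral_sub (integrable_const _) hdiv, integral_div,
      integral_sub (integrable_const _) (hpi i)]
    simp only [integral_const, probReal_univ, one_smul]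
    refine mul_le_mul_of_nonneg_left ?_ (div_nonneg (sub_nonneg.2 hc1) hk.le)
    have := A.le_integral_present ρ _ i t (hA i)
    have : (1 - ∫ r, ∫ x, A.present i t r x ∂rewardLaw (hardInstance n p i) ∂ρ) / δ ≤ 1 := by
      rw [div_le_one hδ]; linarith
    linarith
  have hw' := Finset.sum_le_sum fun i (_ : i ∈ Finset.univ) => hw i
  simp only [integral_const, probReal_univ, one_smul] at h
  rw [Finset.sum_const, Finset.card_univ, Fintype.card_fin, nsmul_eq_mul] at hw'
  have hn0 : (0 : ℝ) ≤ n := Nat.cast_nonneg n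
  have hfin : ∑ _i : Fin n, X ≤ ∑ i : Fin n,
      ∫ r, ∫ x, A.excess t r x ∂rewardLaw (hardInstance n p i) ∂ρ := by
    rw [Finset.sum_const, Finset.card_univ, Fintype.card_fin, nsmul_eq_mul]
    refine le_trans ?_ h
    have := mul_le_mul_of_nonneg_left hw' hn0
    rw [hX]
    linarith
  have : Nonempty (Fin n) := ⟨⟨0, hn⟩⟩
  obtain ⟨i, -, hi⟩ := Finset.exists_le_of_sum_le Finset.univ_nonempty hfin
  refine ⟨i, (ENNReal.ofReal_le_ofReal hi).trans ?_⟩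
  rw [← integral_prod (fun q : R × Rewards n => A.excess t q.1 q.2) (hint i),
    ofReal_integral_eq_lintegral_ofReal (hint i)
      (.of_forall fun q => A.excess_nonneg hn t q.1 q.2)]
  exact lintegral_mono fun q => A.ofReal_excess_le_queries hn t q.1 q.2

end EliminationAlgorithm

/-! ### Numerical estimates -/

theorem entropy_eq {p : I} {u : ℝ} (hu : (p : ℝ) = 1 / 2 + u) (h0 : 0 ≤ u) (h1 : u < 1 / 2) :
    entropy p = -Real.log (1 - 4 * u ^ 2) / 2 := by
  rw [entropy, ← Real.log_mul (by rw [hu]; linarith) (by rw [hu]; linarith), hu]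
  congr 3
  ring

theorem two_mul_sq_le_entropy {p : I} {u : ℝ} (hu : (p : ℝ) = 1 / 2 + u) (h0 : 0 ≤ u)
    (h1 : u < 1 / 2) : 2 * u ^ 2 ≤ entropy p := by
  rw [entropy_eq hu h0 h1]
  have := Real.log_le_sub_one_of_pos (show 0 < 1 - 4 * u ^ 2 by nlinarith)
  linarith

theorem entropy_mul_le {p : I} {u : ℝ} (hu : (p : ℝ) = 1 / 2 + u) (h0 : 0 ≤ u)
    (h1 : u < 1 / 2) : entropy p * (1 - 4 * u ^ 2) ≤ 2 * u ^ 2 := by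
  rw [entropy_eq hu h0 h1]
  have h2 : 0 < 1 - 4 * u ^ 2 := by nlinarith
  have := Real.one_sub_inv_le_log_of_pos h2
  have h3 := mul_le_mul_of_nonneg_right this h2.le
  rw [sub_mul, inv_mul_cancel₀ h2.ne'] at h3
  linarith

theorem mean_hardInstance (n : ℕ) (p : I) (i a : Fin n) :
    mean (hardInstance n p i) a = if a = i then (p : ℝ) else 1 / 2 := by
  have h : ∀ q : I, ∫ x, (x : ℝ) ∂(bernoulliArm q : Measure I) = q := fun q => by
    have := integral_bernoulliMeasure (1 : I) 0 q fun x => (x : ℝ)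
    simpa [bernoulliArm] using this
  unfold mean hardInstance
  rw [h]
  split_ifs <;> rfl

theorem EliminationAlgorithm.Learns.hardInstance {n : ℕ} {R : Type*} [MeasurableSpace R]
    {ρ : Measure R} {A : EliminationAlgorithm n R} {ε δ : ℝ} (h : A.Learns ρ ε δ) {p : I}
    (hp : 1 / 2 + ε < (p : ℝ)) (i : Fin n) :
    ENNReal.ofReal (1 - δ) ≤ A.probReturns ρ (BestArm.hardInstance n p i) fun a => a = i := by
  refine (h _).trans (measure_mono ?_)
  rintro q ⟨a, ha, hr⟩
  refine ⟨a, ?_, hr⟩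
  by_contra hne
  have := ha i
  rw [mean_hardInstance, mean_hardInstance, if_pos rfl, if_neg hne] at this
  linarith

/-- The slack `b / 48` costs a factor `1 + b / 16` in `u²`, and `ε < b / 16` gives `4u² ≤ b / 16`;
together they fit into `1 + b / 4`. -/
theorem entropy_le {b ε u : ℝ} {p : I} (hb0 : 0 < b) (hb1 : b ≤ 1) (hε0 : 0 < ε)
    (hε : ε < b / 16) (hu : (p : ℝ) = 1 / 2 + u) (hu0 : 0 ≤ u) (hu1 : u < (1 + b / 48) * ε) :
    entropy p ≤ 2 * ε ^ 2 * (1 + b / 4) := by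
  have hu2 : u < 2 * ε := by nlinarith
  have hk := entropy_mul_le hu hu0 (by linarith)
  have hs : u ^ 2 ≤ ((1 + b / 48) * ε) ^ 2 := pow_le_pow_left₀ hu0 hu1.le 2
  have hs2 : u ^ 2 ≤ (1 + b / 16) * ε ^ 2 := by
    refine hs.trans ?_
    rw [mul_pow]
    exact mul_le_mul_of_nonneg_right (by nlinarith) (sq_nonneg ε)
  have hs3 : 4 * u ^ 2 ≤ b / 16 := by nlinarith
  have hd : 0 < 1 - 4 * u ^ 2 := by linarith
  refine le_of_mul_le_mul_right (hk.trans ?_) hd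
  have h1 : 1 + b / 16 ≤ (1 + b / 4) * (1 - 4 * u ^ 2) := by nlinarith
  have := mul_le_mul_of_nonneg_left h1 (sq_nonneg ε)
  nlinarith

/-- Each summand of the threshold makes one of the two error terms at most `g * n / 2`. -/
theorem lower_order_le {t : ℕ} {g : ℝ} (hg : 0 < g) {n : ℕ}
    (hn : 2 * t / g + 4 * t ^ 2 * 2 ^ t / g ^ 2 ≤ n) : t + t * √(n * 2 ^ t) ≤ g * n := by
  have h1 : 2 * t / g ≤ n := le_trans (le_add_of_nonneg_right (by positivity)) hn
  have h2 : 4 * t ^ 2 * 2 ^ t / g ^ 2 ≤ (n : ℝ) :=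
    le_trans (le_add_of_nonneg_left (by positivity)) hn
  rw [div_le_iff₀ hg] at h1
  rw [div_le_iff₀ (by positivity)] at h2
  have h3 : (t : ℝ) * √(n * 2 ^ t) ≤ g * n / 2 := by
    refine abs_le_of_sq_le_sq' ?_ (by positivity) |>.2
    rw [mul_pow, Real.sq_sqrt (by positivity)]
    have := mul_le_mul_of_nonneg_left h2 (Nat.cast_nonneg (α := ℝ) n)
    nlinarith
  linarith

theorem main_term_ge {b ε k Λ : ℝ} (hb0 : 0 < b) (hb1 : b ≤ 1) (hε0 : 0 < ε) (hk0 : 0 < k)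
    (hk : k ≤ 2 * ε ^ 2 * (1 + b / 4)) (hΛ : 8 / b ≤ Λ) :
    (1 / 2 - b / 4) * (Λ / ε ^ 2) ≤ (1 - b / 8) / k * (Λ - 1) := by
  have h8 : 1 ≤ b / 8 * Λ := by
    rw [div_le_iff₀ hb0] at hΛ; linarith
  have hΛ0 : 0 < Λ := (by positivity : 0 < 8 / b).trans_le hΛ
  rw [← mul_div_assoc, div_mul_eq_mul_div, div_le_div_iff₀ (by positivity) hk0]
  have hq : 0 ≤ (1 / 2 - b / 4) * Λ := mul_nonneg (by linarith) hΛ0.le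
  refine (mul_le_mul_of_nonneg_left hk hq).trans ?_
  have h1 : (1 - b / 8) * Λ ≤ Λ - 1 := by linarith
  have h2 : (1 - b / 8) * ((1 - b / 8) * Λ) ≤ (1 - b / 8) * (Λ - 1) :=
    mul_le_mul_of_nonneg_left h1 (by linarith)
  have h3 : (1 / 2 - b / 4) * (2 * (1 + b / 4)) * Λ ≤ (1 - b / 8) * (Λ - 1) := by
    have h4 : (1 / 2 - b / 4) * (2 * (1 + b / 4)) ≤ (1 - b / 8) * (1 - b / 8) := by
      nlinarith [sq_nonneg b]
    have := mul_le_mul_of_nonneg_right h4 hΛ0.le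
    linarith
  have := mul_le_mul_of_nonneg_right h3 (sq_nonneg ε)
  linarith

end BestArm

/-! ### Choice of the constants -/

theorem mainTheorem2 (β : ℝ) (hβ : 0 < β) :
    ∃ ε₀ : ℝ, 0 < ε₀ ∧ ∃ δ₀ : ℝ, 0 < δ₀ ∧ ∃ η : ℝ, 0 < η ∧
      ∀ ε : ℝ, 0 < ε → ε < ε₀ → ∀ δ : ℝ, 0 < δ → δ < δ₀ →
        ∃ n₀ : ℕ, ∀ n : ℕ, n₀ < n →
          ∀ (R : Type*) [MeasurableSpace R] (ρ : Measure R) [IsProbabilityMeasure ρ]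
            (A : BestArm.EliminationAlgorithm n R),
            (A.Learns ρ ε δ →
              ∃ D : BestArm.Bandit n,
                ENNReal.ofReal ((1 / 2 - β) * (n / ε ^ 2) * Real.log (1 / δ)) ≤
                  A.expectedQueries ρ D) ∧
            (∀ p : unitInterval, 1 / 2 + ε ≤ (p : ℝ) → (p : ℝ) < 1 / 2 + (1 + η) * ε →
              (∀ i : Fin n, ENNReal.ofReal (1 - δ) ≤
                A.probReturns ρ (BestArm.hardInstance n p i) (fun a => a = i)) →
              ∃ i : Fin n,
                ENNReal.ofReal ((1 / 2 - β) * (n / ε ^ 2) * Real.log (1 / δ)) ≤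
                  A.expectedQueries ρ (BestArm.hardInstance n p i)) := by
  obtain ⟨b, hb0, hb1, hbβ⟩ : ∃ b : ℝ, 0 < b ∧ b ≤ 1 ∧ b ≤ β :=
    ⟨min β 1, lt_min hβ one_pos, min_le_right _ _, min_le_left _ _⟩
  -- The bound on `δ` gives `log (1 / δ) ≥ 8 / b`, so that the loss of `1` in `log (1 / δ) - 1` is
  -- at most a fraction `b / 8`.
  refine ⟨b / 16, by positivity, Real.exp (-(8 / b)), Real.exp_pos _, b / 48, by positivity, ?_⟩
  intro ε hε0 hε δ hδ0 hδ
  set Λ := Real.log (1 / δ) with hΛdef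
  have hΛ : 8 / b ≤ Λ := by
    have := Real.log_lt_log hδ0 hδ
    rw [Real.log_exp] at this
    rw [hΛdef, one_div, Real.log_inv]
    linarith
  have hΛ0 : 0 < Λ := (by positivity : 0 < 8 / b).trans_le hΛ
  -- The horizon is long enough for the weight `c = b / 8` on arms that are kept; it uses only
  -- `entropy p ≥ 2ε²`, so it is independent of `p` and `n`.
  set t : ℕ := ⌈Λ / (2 * ε ^ 2 * (b / 8))⌉₊ with htdef
  have htΛ : Λ ≤ t * (2 * ε ^ 2 * (b / 8)) := by
    rw [← div_le_iff₀ (by positivity)]; exact Nat.le_ceil _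
  set g : ℝ := b / 2 * (Λ / ε ^ 2) with hgdef
  have hg : 0 < g := by positivity
  refine ⟨⌈2 * t / g + 4 * t ^ 2 * 2 ^ t / g ^ 2⌉₊, fun n hn R _ ρ _ A => ?_⟩
  have hn0 : 0 < n := (Nat.zero_le _).trans_lt hn
  have hnR : (0 : ℝ) < n := by exact_mod_cast hn0
  have hlow := BestArm.lower_order_le hg ((Nat.le_ceil _).trans (Nat.cast_le.2 hn.le))
  have part2 : ∀ p : unitInterval, 1 / 2 + ε ≤ (p : ℝ) → (p : ℝ) < 1 / 2 + (1 + b / 48) * ε →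
      (∀ i : Fin n, ENNReal.ofReal (1 - δ) ≤
        A.probReturns ρ (BestArm.hardInstance n p i) (fun a => a = i)) →
      ∃ i : Fin n, ENNReal.ofReal ((1 / 2 - β) * (n / ε ^ 2) * Λ) ≤
        A.expectedQueries ρ (BestArm.hardInstance n p i) := by
    intro p hp1 hp2 hA
    obtain ⟨u, hu⟩ : ∃ u : ℝ, (p : ℝ) = 1 / 2 + u := ⟨p - 1 / 2, by ring⟩
    have hu0 : ε ≤ u := by linarith
    have hu1 : u < (1 + b / 48) * ε := by linarith
    have hu2 : u < 1 / 2 := by nlinarith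
    have hk1 : 2 * ε ^ 2 ≤ BestArm.entropy p :=
      (mul_le_mul_of_nonneg_left (pow_le_pow_left₀ hε0.le hu0 2) zero_le_two).trans
        (BestArm.two_mul_sq_le_entropy hu (hε0.le.trans hu0) hu2)
    have hk0 : 0 < BestArm.entropy p := lt_of_lt_of_le (by positivity) hk1
    have hk2 := BestArm.entropy_le hb0 hb1 hε0 hε hu (hε0.le.trans hu0) hu1
    have ht : (1 - b / 8) * Λ ≤ b / 8 * (t * BestArm.entropy p) := by
      have h1 : (1 - b / 8) * Λ ≤ Λ := by nlinarith
      have h2 : (t : ℝ) * (2 * ε ^ 2 * (b / 8)) ≤ b / 8 * (t * BestArm.entropy p) := by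
        have := mul_le_mul_of_nonneg_left hk1 (by positivity : 0 ≤ b / 8 * (t : ℝ))
        linarith
      linarith
    obtain ⟨i, hi⟩ := A.exists_le_expectedQueries ρ hn0 (by linarith) (by linarith) hk0 t hδ0
      (by positivity) (by linarith) ht hA
    refine ⟨i, (ENNReal.ofReal_le_ofReal ?_).trans hi⟩
    have hm := mul_le_mul_of_nonneg_left
      (BestArm.main_term_ge hb0 hb1 hε0 hk0 hk2 hΛ) hnR.le
    -- The main term loses `b / 4` and the lower-order terms lose `b / 2`; the total is below `b ≤
    -- β`.
    have hq : 0 ≤ (β - b / 4 - b / 2) * (n * (Λ / ε ^ 2)) :=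
      mul_nonneg (by linarith) (by positivity)
    have e : (1 / 2 - β) * (n / ε ^ 2) * Λ = n * ((1 / 2 - b / 4) * (Λ / ε ^ 2)) - g * n -
        (β - b / 4 - b / 2) * (n * (Λ / ε ^ 2)) := by
      rw [hgdef]; ring
    rw [e]
    linarith
  refine ⟨fun hL => ?_, part2⟩
  have hη : (1 + b / 96) * ε ≤ 1 / 2 := by nlinarith
  -- Half of the slack `b / 48` puts `p` strictly above `1/2 + ε`, so that the fair coins are not
  -- `ε`-best.
  obtain ⟨i, hi⟩ := part2 ⟨1 / 2 + (1 + b / 96) * ε, by positivity, by linarith⟩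
    (by simp only; nlinarith) (by simp only; nlinarith)
    fun i => hL.hardInstance (by simp only; nlinarith [mul_pos hb0 hε0]) i
  exact ⟨_, hi⟩
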